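/- Let $\mathbb K$ be $\mathbb R$ or $\mathbb C$. Let $\widetilde{\mathbb K}=\mathcal E_M/\mathcal N$ be the ring of Colombeau generalized numbers, where $$\mathcal E_M=\{(x_\varepsilon)_\varepsilon\in\mathbb K^{(0,1)}:(\exists a\in\mathbb R)(\exists\varepsilon_0\in(0,1))(\forall\varepsilon\le\varepsilon_0)\ |x_\varepsilon|\le\varepsilon^a\},$$ $$\mathcal N=\{(x_\varepsilon)_\varepsilon\in\mathbb K^{(0,1)}:(\forall a\in\mathbb R)(\exists\varepsilon_0\in(0,1))(\forall\varepsilon\le\varepsilon_0)\ |x_\varepsilon|\le\varepsilon^a\}.$$ Equip $\widetilde{\mathbb K}$ with the sharp topology, i.e. the topology of the ultrametric $d(x,y)=e^{-v(x-y)}$ (with $e^{-\infty}=0$), where, for any representative $(x_\varepsilon)_\varepsilon$ of $x$, $$v(x)=\sup\{a\in\mathbb R:(\exists\varepsilon_0\in(0,1))(\forall\varepsilon\le\varepsilon_0)\ |x_\varepsilon|\le\varepsilon^a\}\in(-\infty,+\infty].$$ For $S\subseteq(0,1)$ let $S^c=(0,1)\setminus S$, and let $e_S\in\widetilde{\mathbb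 K}$ be the class of the characteristic function of $S$. Let $\mathcal S=\{S\subseteq(0,1):0\in\overline S\cap\overline{S^c}\}$, and let $P_*(\mathcal S)$ be the set of all $\mathcal F\subseteq\mathcal S$ that are closed under finite (non-empty) unions and such that for each $S\in\mathcal S$, $S\in\mathcal F$ or $S^c\in\mathcal F$. For $\mathcal F\subseteq\mathcal S$, let $g(\mathcal F)$ be the ideal of $\widetilde{\mathbb K}$ generated by $\{e_S:S\in\mathcal F\}$. **Theorem.** Assume the continuum hypothesis $2^{\aleph_0}=\aleph_1$. Then there exists $\mathcal F\in P_*(\mathcal S)$ such that the ideal $g(\mathcal F)$ is closed in the sharp topology; moreover this $g(\mathcal F)$ is a maximal ideal and a minimal prime ideal of $\widetilde{\mathbb K}$. In particular, some minimal prime ideals of $\widetilde{\mathbb K}$ are maximal ideals. -/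

import Mathlib

open Set

noncomputable section

namespace Colombeau

/-- The parameter set: the open interval of real numbers strictly between `0` and `1`. -/
abbrev Param : Type := Ioo (0 : ℝ) 1

variable {𝕂 : Type*} [RCLike 𝕂]

/-- `IsBigPow x a` says that `|x_ε| ≤ ε ^ a` for all sufficiently small `ε`. -/
def IsBigPow (x : Param → 𝕂) (a : ℝ) : Prop :=
  ∃ ε₀ : Param, ∀ ε : Param, ε ≤ ε₀ → ‖x ε‖ ≤ (ε : ℝ) ^ a

/-- Moderate nets. -/
def IsModerate (x : Param → 𝕂) : Prop := ∃ a : ℝ, IsBigPow x a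

/-- Negligible nets. -/
def IsNegligible (x : Param → 𝕂) : Prop := ∀ a : ℝ, IsBigPow x a

theorem IsBigPow.mono {x : Param → 𝕂} {a b : ℝ} (h : IsBigPow x a) (hab : b ≤ a) :
    IsBigPow x b := by
  obtain ⟨e, he⟩ := h
  exact ⟨e, fun ε hε => (he ε hε).trans
    (Real.rpow_le_rpow_of_exponent_ge ε.2.1 ε.2.2.le hab)⟩

theorem IsBigPow.neg {x : Param → 𝕂} {a : ℝ} (h : IsBigPow x a) : IsBigPow (-x) a := by
  obtain ⟨e, he⟩ := h
  exact ⟨e, fun ε hε => by simpa using he ε hε⟩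

theorem IsBigPow.mul {x y : Param → 𝕂} {a b : ℝ} (hx : IsBigPow x a) (hy : IsBigPow y b) :
    IsBigPow (x * y) (a + b) := by
  obtain ⟨e, he⟩ := hx
  obtain ⟨f, hf⟩ := hy
  refine ⟨min e f, fun ε hε => ?_⟩
  have h0 : (0 : ℝ) < ε := ε.2.1
  rw [Pi.mul_apply, norm_mul, Real.rpow_add h0]
  exact mul_le_mul (he ε (hε.trans (min_le_left _ _))) (hf ε (hε.trans (min_le_right _ _)))
    (norm_nonneg _) (Real.rpow_nonneg h0.le _)

theorem IsBigPow.add {x y : Param → 𝕂} {a b : ℝ} (hx : IsBigPow x a) (hy : IsBigPow y a)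
    (hb : b < a) : IsBigPow (x + y) b := by
  obtain ⟨e, he⟩ := hx
  obtain ⟨f, hf⟩ := hy
  have hc : 0 < a - b := sub_pos.2 hb
  have hd0 : (0 : ℝ) < (1 / 2 : ℝ) ^ (1 / (a - b)) := by positivity
  have hd1 : (1 / 2 : ℝ) ^ (1 / (a - b)) < 1 :=
    Real.rpow_lt_one (by norm_num) (by norm_num) (by positivity)
  refine ⟨min (min e f) ⟨_, hd0, hd1⟩, fun ε hε => ?_⟩
  have h0 : (0 : ℝ) < ε := ε.2.1
  have h1 := he ε (hε.trans ((min_le_left _ _).trans (min_le_left _ _)))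
  have h2 := hf ε (hε.trans ((min_le_left _ _).trans (min_le_right _ _)))
  have h3 : (ε : ℝ) ≤ (1 / 2 : ℝ) ^ (1 / (a - b)) := hε.trans (min_le_right _ _)
  have h4 : (ε : ℝ) ^ (a - b) ≤ 1 / 2 := by
    refine (Real.rpow_le_rpow h0.le h3 hc.le).trans ?_
    rw [← Real.rpow_mul (by norm_num), one_div_mul_cancel hc.ne', Real.rpow_one]
  have h5 : (ε : ℝ) ^ a = (ε : ℝ) ^ (a - b) * (ε : ℝ) ^ b := by
    rw [← Real.rpow_add h0]; ring_nf
  have h6 : 0 ≤ (ε : ℝ) ^ b := Real.rpow_nonneg h0.le _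
  calc ‖(x + y) ε‖ ≤ ‖x ε‖ + ‖y ε‖ := norm_add_le _ _
    _ ≤ (ε : ℝ) ^ (a - b) * (ε : ℝ) ^ b + (ε : ℝ) ^ (a - b) * (ε : ℝ) ^ b := by
        rw [← h5]; exact add_le_add h1 h2
    _ ≤ (ε : ℝ) ^ b := by nlinarith

theorem IsNegligible.isModerate {x : Param → 𝕂} (h : IsNegligible x) : IsModerate x :=
  ⟨0, h 0⟩

theorem isNegligible_zero : IsNegligible (0 : Param → 𝕂) := fun a =>
  ⟨⟨1 / 2, by norm_num, by norm_num⟩, fun ε _ => by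
    simpa using Real.rpow_nonneg ε.2.1.le a⟩

theorem isBigPow_of_norm_le_one {x : Param → 𝕂} (h : ∀ ε, ‖x ε‖ ≤ 1) : IsBigPow x 0 :=
  ⟨⟨1 / 2, by norm_num, by norm_num⟩, fun ε _ => by simpa using h ε⟩

variable (𝕂) in
/-- The ring of moderate nets, with componentwise operations. -/
def moderate : Subring (Param → 𝕂) where
  carrier := {x | IsModerate x}
  zero_mem' := isNegligible_zero.isModerate
  one_mem' := ⟨0, isBigPow_of_norm_le_one fun _ => by simp⟩
  neg_mem' := fun ⟨a, h⟩ => ⟨a, h.neg⟩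
  mul_mem' := fun ⟨a, h⟩ ⟨b, k⟩ => ⟨a + b, h.mul k⟩
  add_mem' := fun ⟨a, h⟩ ⟨b, k⟩ => ⟨min a b - 1,
    (h.mono (min_le_left a b)).add (k.mono (min_le_right a b)) (by linarith)⟩

variable (𝕂) in
/-- The ideal of negligible nets. -/
def negligible : Ideal (moderate 𝕂) where
  carrier := {x | IsNegligible (x : Param → 𝕂)}
  zero_mem' := isNegligible_zero
  add_mem' := fun h k a => (h (a + 1)).add (k (a + 1)) (by linarith)
  smul_mem' := fun c x h a => by
    obtain ⟨b, hb⟩ := c.2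
    have := hb.mul (h (a - b))
    rwa [add_sub_cancel] at this

variable (𝕂) in
/-- The ring of Colombeau generalized numbers: moderate nets modulo negligible nets. -/
def GenNum : Type _ := moderate 𝕂 ⧸ negligible 𝕂

instance : CommRing (GenNum 𝕂) := inferInstanceAs (CommRing (moderate 𝕂 ⧸ negligible 𝕂))

/-- The class of a moderate net. -/
def GenNum.mk : moderate 𝕂 →+* GenNum 𝕂 := Ideal.Quotient.mk (negligible 𝕂)

/-- The valuation of a net, with values in the extended real numbers. -/
def netVal (x : Param → 𝕂) : EReal := sSup ((fun a : ℝ => (a : EReal)) '' {a | IsBigPow x a})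

theorem le_netVal {x : Param → 𝕂} {a : ℝ} (h : IsBigPow x a) : (a : EReal) ≤ netVal x :=
  le_sSup ⟨a, h, rfl⟩

theorem isBigPow_of_lt {x : Param → 𝕂} {a : ℝ} (h : (a : EReal) < netVal x) : IsBigPow x a := by
  obtain ⟨_, ⟨b, hb, rfl⟩, hab⟩ := lt_sSup_iff.1 h
  exact IsBigPow.mono hb (EReal.coe_lt_coe_iff.1 hab).le

theorem netVal_neg (x : Param → 𝕂) : netVal (-x) = netVal x := by
  unfold netVal
  congr 2
  ext a
  exact ⟨fun h => by simpa using IsBigPow.neg h, fun h => IsBigPow.neg h⟩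

theorem netVal_eq_top {x : Param → 𝕂} : netVal x = ⊤ ↔ IsNegligible x := by
  constructor
  · intro h a
    exact isBigPow_of_lt (h ▸ EReal.coe_lt_top a)
  · intro h
    exact EReal.eq_top_iff_forall_lt _ |>.2 fun a =>
      (EReal.coe_lt_coe_iff.2 (lt_add_one a)).trans_le (le_netVal (h (a + 1)))

theorem netVal_ne_bot {x : Param → 𝕂} (h : IsModerate x) : netVal x ≠ ⊥ := by
  obtain ⟨a, ha⟩ := h
  exact ((EReal.bot_lt_coe a).trans_le (le_netVal ha)).ne'

theorem min_le_netVal_add (x y : Param → 𝕂) :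
    min (netVal x) (netVal y) ≤ netVal (x + y) := by
  refine EReal.ge_of_forall_gt_iff_ge.1 fun c hc => ?_
  obtain ⟨a, hca, ha⟩ := EReal.lt_iff_exists_real_btwn.1 hc
  exact le_netVal ((isBigPow_of_lt (ha.trans_le (min_le_left _ _))).add
    (isBigPow_of_lt (ha.trans_le (min_le_right _ _))) (EReal.coe_lt_coe_iff.1 hca))

theorem netVal_le_of_negligible_sub {x y : Param → 𝕂} (h : IsNegligible (y - x)) :
    netVal x ≤ netVal y := by
  have := min_le_netVal_add x (y - x)
  rwa [netVal_eq_top.2 h, min_top_right, add_sub_cancel] at this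

theorem netVal_congr {x y : Param → 𝕂} (h : IsNegligible (x - y)) : netVal x = netVal y := by
  refine le_antisymm (netVal_le_of_negligible_sub ?_) (netVal_le_of_negligible_sub h)
  intro a
  simpa using (h a).neg

/-- The valuation of a generalized number: that of any representative. -/
def GenNum.val : GenNum 𝕂 → EReal :=
  Quotient.lift (fun u : moderate 𝕂 => netVal (u : Param → 𝕂)) fun _ _ h =>
    netVal_congr ((Submodule.quotientRel_def (negligible 𝕂)).1 h)

/-- The sharp norm `exp (-val x)`, with the convention `exp (-∞) = 0`. -/
def GenNum.sharpNorm (x : GenNum 𝕂) : ℝ := (EReal.exp (-x.val)).toReal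

theorem GenNum.mk_surjective : Function.Surjective (GenNum.mk : moderate 𝕂 → GenNum 𝕂) :=
  Ideal.Quotient.mk_surjective

theorem GenNum.val_mk (u : moderate 𝕂) : (GenNum.mk u).val = netVal (u : Param → 𝕂) := rfl

theorem GenNum.mk_eq_zero (u : moderate 𝕂) :
    GenNum.mk u = 0 ↔ IsNegligible (u : Param → 𝕂) :=
  Ideal.Quotient.eq_zero_iff_mem

theorem GenNum.exp_ne_top (x : GenNum 𝕂) : EReal.exp (-x.val) ≠ ⊤ := by
  obtain ⟨u, rfl⟩ := GenNum.mk_surjective x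
  simpa [GenNum.val_mk] using netVal_ne_bot u.2

theorem GenNum.sharpNorm_neg (x : GenNum 𝕂) : (-x).sharpNorm = x.sharpNorm := by
  obtain ⟨u, rfl⟩ := GenNum.mk_surjective x
  unfold GenNum.sharpNorm
  rw [← map_neg, GenNum.val_mk, GenNum.val_mk, Subring.coe_neg, netVal_neg]

theorem GenNum.sharpNorm_eq_zero (x : GenNum 𝕂) : x.sharpNorm = 0 ↔ x = 0 := by
  unfold GenNum.sharpNorm
  rw [ENNReal.toReal_eq_zero_iff, or_iff_left x.exp_ne_top]
  obtain ⟨u, rfl⟩ := GenNum.mk_surjective x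
  rw [GenNum.mk_eq_zero, EReal.exp_eq_zero_iff, GenNum.val_mk, EReal.neg_eq_bot_iff,
    netVal_eq_top]

theorem GenNum.sharpNorm_add_le_max (x y : GenNum 𝕂) :
    (x + y).sharpNorm ≤ max x.sharpNorm y.sharpNorm := by
  have key : min x.val y.val ≤ (x + y).val := by
    obtain ⟨u, rfl⟩ := GenNum.mk_surjective x
    obtain ⟨v, rfl⟩ := GenNum.mk_surjective y
    rw [← map_add]
    exact min_le_netVal_add _ _
  unfold GenNum.sharpNorm
  rcases min_le_iff.1 key with h | h
  · exact le_max_of_le_left (ENNReal.toReal_mono x.exp_ne_top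
      (EReal.exp_monotone (EReal.neg_le_neg_iff.2 h)))
  · exact le_max_of_le_right (ENNReal.toReal_mono y.exp_ne_top
      (EReal.exp_monotone (EReal.neg_le_neg_iff.2 h)))

theorem GenNum.sharpNorm_nonneg (x : GenNum 𝕂) : 0 ≤ x.sharpNorm := ENNReal.toReal_nonneg

/-- The ultrametric `d(x, y) = sharpNorm (x - y)`; its topology is the sharp topology. -/
instance : MetricSpace (GenNum 𝕂) where
  dist x y := (x - y).sharpNorm
  dist_self x := (GenNum.sharpNorm_eq_zero _).2 (sub_self x)
  dist_comm x y := by rw [← GenNum.sharpNorm_neg, neg_sub]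
  dist_triangle x y z := by
    have h := GenNum.sharpNorm_add_le_max (x - y) (y - z)
    rw [sub_add_sub_cancel] at h
    exact h.trans (max_le_add_of_nonneg (GenNum.sharpNorm_nonneg _) (GenNum.sharpNorm_nonneg _))
  eq_of_dist_eq_zero h := sub_eq_zero.1 ((GenNum.sharpNorm_eq_zero _).1 h)

theorem indicator_mem_moderate (S : Set Param) : S.indicator (1 : Param → 𝕂) ∈ moderate 𝕂 :=
  ⟨0, isBigPow_of_norm_le_one fun ε => by
    by_cases h : ε ∈ S <;> simp [h]⟩

variable (𝕂) in
/-- The idempotent `e_S`: the class of the characteristic function of `S`. -/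
def e (S : Set Param) : GenNum 𝕂 := GenNum.mk ⟨S.indicator 1, indicator_mem_moderate S⟩

/-- `0` is in the closure (in the real line) of `S`. -/
def ZeroAdherent (S : Set Param) : Prop := (0 : ℝ) ∈ closure ((fun ε : Param => (ε : ℝ)) '' S)

/-- The family of the subsets `S` of the parameter interval such that `0` is in the closure
both of `S` and of its complement. -/
def sets : Set (Set Param) := {S | ZeroAdherent S ∧ ZeroAdherent Sᶜ}

/-- The set of the subfamilies of `sets` that are closed under finite union and contain,
for each member `S` of `sets`, either `S` or its complement. -/
def PStar : Set (Set (Set Param)) :=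
  {F | F ⊆ sets ∧ (∀ S ∈ F, ∀ T ∈ F, S ∪ T ∈ F) ∧ ∀ S ∈ sets, S ∈ F ∨ Sᶜ ∈ F}

variable (𝕂) in
/-- The ideal generated by the idempotents `e_S`, where `S` ranges over `F`. -/
def g (F : Set (Set Param)) : Ideal (GenNum 𝕂) := Ideal.span (e 𝕂 '' F)

end Colombeau

end

/-! Take an ultrafilter `U` of parameter sets converging to `0`, and let `F` consist of the members
of `sets` whose complement is in `U`. Then `x` lies in the ideal exactly when `x * e_T = 0` for some
`T ∈ U` (`mem_g_iff`). If `U` is a P-point, the countably many conditions `|u_ε| ≤ ε ^ m`, each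
valid on a member of `U`, can be merged into negligibility on a single member (`mk_mem_g`). So
membership is tested one exponent at a time. Such a test survives sharp limits, which gives
closedness; and if it fails at `m`, then `u` is invertible on a member of `U`, which gives
maximality. Minimality needs only `e_S * e_{Sᶜ} = 0`: a prime inside the ideal contains one factor,
and `e_{Sᶜ}` would put `1` in the ideal. The continuum hypothesis yields the P-point: the functions
`ℕ → ℕ` are listed so that each has countably many predecessors, and each is decided by refining the
filters already built. -/

open Filter

/-! ### Transfinite refinement of filters on `ℕ` -/

namespace Filter

/-- A countably generated proper filter on `ℕ` refining the cofinite filter has an infinite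
pseudo-intersection. -/
theorem exists_principal_inf_atTop_le (L : Filter ℕ) [L.NeBot] [L.IsCountablyGenerated]
    (hL : L ≤ atTop) : ∃ X : Set ℕ, (𝓟 X ⊓ atTop).NeBot ∧ 𝓟 X ⊓ atTop ≤ L := by
  obtain ⟨s, hs⟩ := L.exists_seq_tendsto
  refine ⟨range s, NeBot.mono (f := map s atTop) inferInstance
    (le_inf (le_principal_iff.2 (mem_map.2 (univ_mem' fun n => mem_range_self n)))
      (hs.trans hL)), fun A hA => ?_⟩
  have hfin : (s ⁻¹' A)ᶜ.Finite := by
    have : s ⁻¹' A ∈ cofinite := by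
      rw [Nat.cofinite_eq_atTop]
      exact hs hA
    exact this
  rw [inf_comm, mem_inf_principal, ← Nat.cofinite_eq_atTop, mem_cofinite]
  refine (hfin.image s).subset ?_
  intro n hn
  simp only [mem_compl_iff, mem_ofPred_eq, not_forall] at hn
  obtain ⟨⟨k, rfl⟩, hk⟩ := hn
  exact ⟨k, hk, rfl⟩

/-- `L` is the trace of the cofinite filter on some set, and `f` is eventually constant or tends
to infinity along `L`. -/
def Decides (L : Filter ℕ) (f : ℕ → ℕ) : Prop :=
  (∃ X : Set ℕ, L = 𝓟 X ⊓ atTop) ∧ ((∃ k, ∀ᶠ n in L, f n = k) ∨ Tendsto f L atTop)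

/-- If some value is taken frequently, restrict to its fibre; otherwise `f` already tends to
infinity. A pseudo-intersection then restores the form `𝓟 X ⊓ atTop`. -/
theorem exists_le_decides (f : ℕ → ℕ) (L : Filter ℕ) [L.NeBot] [L.IsCountablyGenerated]
    (hL : L ≤ atTop) : ∃ L' ≤ L, L'.NeBot ∧ L'.Decides f := by
  by_cases h : ∃ k, ∃ᶠ n in L, f n = k
  · obtain ⟨k, hk⟩ := h
    have : (L ⊓ 𝓟 {n | f n = k}).NeBot := frequently_mem_iff_neBot.1 hk
    obtain ⟨X, hX, hXL⟩ := exists_principal_inf_atTop_le (L ⊓ 𝓟 {n | f n = k})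
      (inf_le_left.trans hL)
    exact ⟨_, hXL.trans inf_le_left, hX, ⟨X, rfl⟩,
      Or.inl ⟨k, le_principal_iff.1 (hXL.trans inf_le_right)⟩⟩
  · obtain ⟨X, hX, hXL⟩ := exists_principal_inf_atTop_le L hL
    refine ⟨_, hXL, hX, ⟨X, rfl⟩, Or.inr (Tendsto.mono_left ?_ hXL)⟩
    push Not at h
    rw [← Nat.cofinite_eq_atTop]
    exact le_cofinite_iff_eventually_ne.2 fun k => eventually_map.2 (h k)

theorem Decides.isCountablyGenerated {L : Filter ℕ} {f : ℕ → ℕ} (h : L.Decides f) :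
    L.IsCountablyGenerated := by
  obtain ⟨⟨X, rfl⟩, -⟩ := h
  infer_instance

theorem Decides.le_atTop {L : Filter ℕ} {f : ℕ → ℕ} (h : L.Decides f) : L ≤ atTop := by
  obtain ⟨⟨X, rfl⟩, -⟩ := h
  exact inf_le_right

section Recursion

variable {α : Type*} [LinearOrder α] [WellFoundedLT α] (φ : α → ℕ → ℕ)

open Classical in
/-- A transfinite sequence of filters, where the stage `i` refines the preceding ones and
decides `φ i`. -/
noncomputable def decidingFilter : α → Filter ℕ :=
  (wellFounded_lt (α := α)).fix fun i T =>
    if h : ∃ L : Filter ℕ, L.NeBot ∧ (∀ k (hk : k < i), L ≤ T k hk) ∧ L.Decides (φ i)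
    then h.choose else ⊥

theorem decidingFilter_eq (i : α)
    (h : ∃ L : Filter ℕ, L.NeBot ∧ (∀ k < i, L ≤ decidingFilter φ k) ∧ L.Decides (φ i)) :
    (decidingFilter φ i).NeBot ∧ (∀ k < i, decidingFilter φ i ≤ decidingFilter φ k) ∧
      (decidingFilter φ i).Decides (φ i) := by
  have key : decidingFilter φ i = h.choose := by
    conv_lhs => rw [decidingFilter, WellFounded.fix_eq]
    exact dif_pos h
  rw [key]
  exact h.choose_spec

/-- The earlier stages form a countable chain of proper, countably generated filters, so their
infimum is again proper and countably generated and can be refined. -/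
theorem decidingFilter_spec (hc : ∀ i : α, (Iio i).Countable) (i : α) :
    (decidingFilter φ i).NeBot ∧ (∀ k < i, decidingFilter φ i ≤ decidingFilter φ k) ∧
      (decidingFilter φ i).Decides (φ i) := by
  induction i using WellFoundedLT.induction with
  | ind i ih =>
    apply decidingFilter_eq
    have := (hc i).to_subtype
    have hcg : ∀ k : Iio i, (decidingFilter φ k.1).IsCountablyGenerated := fun k =>
      (ih k.1 k.2).2.2.isCountablyGenerated
    -- An empty infimum would be `⊤`, which is not below `atTop`.
    rcases isEmpty_or_nonempty (Iio i) with he | hn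
    · obtain ⟨L, -, hL, hd⟩ := exists_le_decides (φ i) atTop le_rfl
      exact ⟨L, hL, fun k hk => (he.false ⟨k, hk⟩).elim, hd⟩
    · have hanti : Antitone fun k : Iio i => decidingFilter φ k.1 := fun a b hab => by
        rcases hab.eq_or_lt with rfl | h
        · exact le_rfl
        · exact (ih b.1 b.2).2.1 a.1 h
      have : (⨅ k : Iio i, decidingFilter φ k.1).NeBot :=
        iInf_neBot_of_directed' hanti.directed_ge fun k => (ih k.1 k.2).1
      obtain ⟨k₀⟩ := hn
      obtain ⟨L, hle, hL, hd⟩ := exists_le_decides (φ i) (⨅ k : Iio i, decidingFilter φ k.1)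
        ((iInf_le _ k₀).trans (ih k₀.1 k₀.2).2.2.le_atTop)
      exact ⟨L, hL, fun k hk => hle.trans (iInf_le _ (⟨k, hk⟩ : Iio i)), hd⟩

end Recursion

end Filter

/-! ### P-points from the continuum hypothesis -/

/-- Under the continuum hypothesis, there is an ultrafilter on `ℕ` that decides all functions. -/
theorem Ultrafilter.exists_le_decides (CH : Cardinal.continuum.{0} = Cardinal.aleph 1) :
    ∃ U : Ultrafilter ℕ, ∀ f : ℕ → ℕ, ∃ L : Filter ℕ, ↑U ≤ L ∧ L.Decides f := by
  let α := Cardinal.continuum.{0}.ord.ToType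
  have hc : ∀ i : α, (Iio i).Countable := fun i => by
    rw [← Cardinal.le_aleph0_iff_set_countable, ← Cardinal.lt_aleph_one_iff, ← CH]
    simpa [α] using Cardinal.mk_Iio_lt i (by simp [α])
  obtain ⟨φ⟩ : Nonempty (α ≃ (ℕ → ℕ)) := Cardinal.eq.1 (by simp [α])
  have hT := decidingFilter_spec φ hc
  have hanti : Antitone (decidingFilter φ) := fun a b hab => by
    rcases hab.eq_or_lt with rfl | h
    · exact le_rfl
    · exact (hT b).2.1 a h
  have : Nonempty α := ⟨φ.symm 0⟩
  have : (⨅ i, decidingFilter φ i).NeBot :=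
    iInf_neBot_of_directed' hanti.directed_ge fun i => (hT i).1
  refine ⟨Ultrafilter.of (⨅ i, decidingFilter φ i), fun f => ⟨decidingFilter φ (φ.symm f),
    (Ultrafilter.of_le _).trans (iInf_le _ _), ?_⟩⟩
  simpa using (hT (φ.symm f)).2.2

/-- Under the continuum hypothesis, there is a nonprincipal ultrafilter on `ℕ` which is a
P-point. -/
theorem Ultrafilter.exists_pPoint (CH : Cardinal.continuum.{0} = Cardinal.aleph 1) :
    ∃ U : Ultrafilter ℕ, (U : Filter ℕ) ≤ cofinite ∧
      ∀ A : ℕ → Set ℕ, (∀ m, A m ∈ U) → ∃ T ∈ U, ∀ m, (T \ A m).Finite := by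
  obtain ⟨U, hU⟩ := Ultrafilter.exists_le_decides CH
  refine ⟨U, ?_, fun A hA => ?_⟩
  · rw [Nat.cofinite_eq_atTop]
    obtain ⟨L, hUL, hL⟩ := hU 0
    exact hUL.trans hL.le_atTop
  classical
  -- One more than the first index whose set misses `n`; `0` means that `n` is in every `A m`. A
  -- constant value `k + 1` on a member of `U` would contradict `A k ∈ U`.
  let f : ℕ → ℕ := fun n => if h : ∃ m, n ∉ A m then Nat.find h + 1 else 0
  have hf : ∀ m n, n ∉ A m → 0 < f n ∧ f n ≤ m + 1 := fun m n hn => by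
    have h : ∃ m, n ∉ A m := ⟨m, hn⟩
    simp only [f, dif_pos h]
    exact ⟨Nat.succ_pos _, Nat.succ_le_succ (Nat.find_min' h hn)⟩
  have hf' : ∀ m n, f n = m + 1 → n ∉ A m := fun m n hn => by
    by_cases h : ∃ m, n ∉ A m
    · simp only [f, dif_pos h, Nat.add_right_cancel_iff] at hn
      exact hn ▸ Nat.find_spec h
    · simp [f, dif_neg h] at hn
  obtain ⟨L, hUL, ⟨X, hX⟩, ⟨k, hk⟩ | hk⟩ := hU f
  · refine ⟨{n | f n = k}, hUL hk, fun m => ?_⟩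
    rcases k with _ | k
    · refine finite_empty.subset fun n hn => ?_
      exact ((hf m n hn.2).1.ne' hn.1).elim
    · obtain ⟨n, hn, hn'⟩ := U.nonempty_of_mem (inter_mem (hUL hk) (hA k))
      exact (hf' k n hn hn').elim
  · refine ⟨X, hUL ?_, fun m => ?_⟩
    · rw [hX]
      exact mem_inf_of_left (mem_principal_self X)
    -- `f > m + 1` holds on `X` up to a finite set, whereas `f ≤ m + 1` off `A m`.
    · have := hk (Ioi_mem_atTop (m + 1))
      rw [Filter.mem_map, hX, inf_comm, mem_inf_principal, ← Nat.cofinite_eq_atTop, mem_cofinite] at this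
      refine this.subset fun n hn hn' => ?_
      exact absurd (hn' hn.1) (not_lt.2 (hf m n hn.2).2)

/-! ### Idempotents and the ideal of an ultrafilter -/

namespace Colombeau

open Filter

variable {𝕂 : Type*} [RCLike 𝕂]

/-- On `Param`, the filter `atBot` expresses `ε → 0`. -/
theorem isBigPow_iff_eventually {x : Param → 𝕂} {a : ℝ} :
    IsBigPow x a ↔ ∀ᶠ ε : Param in atBot, ‖x ε‖ ≤ (ε : ℝ) ^ a :=
  have : Nonempty Param := ⟨⟨1 / 2, by norm_num, by norm_num⟩⟩
  eventually_atBot.symm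

theorem zeroAdherent_iff_frequently {S : Set Param} :
    ZeroAdherent S ↔ ∃ᶠ ε : Param in atBot, ε ∈ S := by
  have : Nonempty Param := ⟨⟨1 / 2, by norm_num, by norm_num⟩⟩
  rw [ZeroAdherent, Metric.mem_closure_iff, frequently_atBot]
  constructor
  · intro h a
    obtain ⟨_, ⟨b, hb, rfl⟩, hd⟩ := h a a.2.1
    rw [Real.dist_eq, zero_sub, abs_neg, abs_of_pos b.2.1] at hd
    exact ⟨b, hd.le, hb⟩
  · intro h r hr
    obtain ⟨b, hb, hS⟩ := h ⟨min (r / 2) (1 / 2), by positivity, by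
      linarith [min_le_right (r / 2) (1 / 2 : ℝ)]⟩
    refine ⟨b, ⟨b, hS, rfl⟩, ?_⟩
    rw [Real.dist_eq, zero_sub, abs_neg, abs_of_pos b.2.1]
    have : (b : ℝ) ≤ min (r / 2) (1 / 2) := hb
    linarith [min_le_left (r / 2) (1 / 2 : ℝ)]

theorem e_mul_e (S T : Set Param) : e 𝕂 S * e 𝕂 T = e 𝕂 (S ∩ T) := by
  rw [e, e, e, ← map_mul]
  congr 1
  ext1
  exact inter_indicator_one.symm

theorem e_add_e_compl (S : Set Param) : e 𝕂 S + e 𝕂 Sᶜ = 1 := by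
  rw [e, e, ← map_add, ← map_one GenNum.mk]
  congr 1
  ext1
  exact indicator_self_add_compl S 1

theorem mk_mul_e_eq_zero_iff {u : moderate 𝕂} {T : Set Param} :
    GenNum.mk u * e 𝕂 T = 0 ↔
      ∀ a : ℝ, ∀ᶠ ε : Param in atBot, ε ∈ T → ‖(u : Param → 𝕂) ε‖ ≤ (ε : ℝ) ^ a := by
  rw [e, ← map_mul, GenNum.mk_eq_zero]
  refine forall_congr' fun a => ?_
  rw [isBigPow_iff_eventually]
  refine eventually_congr (Eventually.of_forall fun ε => ?_)
  by_cases h : ε ∈ T <;> simp [h, Real.rpow_nonneg ε.2.1.le]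

theorem e_eq_zero_of_not_zeroAdherent {S : Set Param} (h : ¬ ZeroAdherent S) : e 𝕂 S = 0 := by
  rw [zeroAdherent_iff_frequently, not_frequently] at h
  rw [e, GenNum.mk_eq_zero]
  intro a
  rw [isBigPow_iff_eventually]
  filter_upwards [h] with ε hε
  simp [hε, Real.rpow_nonneg ε.2.1.le]

theorem not_zeroAdherent_of_e_eq_zero {S : Set Param} (h : e 𝕂 S = 0) : ¬ ZeroAdherent S := by
  rw [e, GenNum.mk_eq_zero] at h
  rw [zeroAdherent_iff_frequently, not_frequently]
  have h1 := isBigPow_iff_eventually.1 (h 1)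
  filter_upwards [h1] with ε hε hS
  have := ε.2.2
  simp [hS] at hε
  linarith

/-- The members of `sets` whose complement is a member of the ultrafilter `U`. -/
def ultrafilterSets (U : Ultrafilter Param) : Set (Set Param) := {S ∈ sets | Sᶜ ∈ U}

theorem zeroAdherent_of_mem {U : Ultrafilter Param} (hU : (U : Filter Param) ≤ atBot)
    {S : Set Param} (hS : S ∈ U) : ZeroAdherent S :=
  zeroAdherent_iff_frequently.2 <|
    Frequently.filter_mono (Eventually.frequently (f := (U : Filter Param)) hS) hU

theorem ultrafilterSets_mem_PStar {U : Ultrafilter Param} (hU : (U : Filter Param) ≤ atBot) :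
    ultrafilterSets U ∈ PStar := by
  refine ⟨fun S hS => hS.1, fun S hS T hT => ?_, fun S hS => ?_⟩
  · have hmem : (S ∪ T)ᶜ ∈ U := by
      rw [compl_union]
      exact inter_mem hS.2 hT.2
    refine ⟨⟨?_, zeroAdherent_of_mem hU hmem⟩, hmem⟩
    rw [zeroAdherent_iff_frequently]
    exact (zeroAdherent_iff_frequently.1 hS.1.1).mono fun ε h => Or.inl h
  · rcases U.mem_or_compl_mem S with h | h
    · exact Or.inr ⟨⟨hS.2, by rw [compl_compl]; exact hS.1⟩, by rwa [compl_compl]⟩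
    · exact Or.inl ⟨hS, h⟩

/-- If `S` does not accumulate at `0` it is not a generator index, but then `e_S = 0`. -/
theorem e_mem_g {U : Ultrafilter Param} (hU : (U : Filter Param) ≤ atBot) {S : Set Param}
    (hS : Sᶜ ∈ U) : e 𝕂 S ∈ g 𝕂 (ultrafilterSets U) := by
  by_cases h : ZeroAdherent S
  · exact Ideal.subset_span ⟨S, ⟨⟨h, zeroAdherent_of_mem hU hS⟩, hS⟩, rfl⟩
  · rw [e_eq_zero_of_not_zeroAdherent h]
    exact zero_mem _

/-- Annihilators `e_S` and `e_T` of two elements combine into `e_{S ∩ T}` for their sum; conversely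
`x * e_T = 0` gives `x = x * e_{Tᶜ}`. -/
theorem mem_g_iff {U : Ultrafilter Param} (hU : (U : Filter Param) ≤ atBot) {x : GenNum 𝕂} :
    x ∈ g 𝕂 (ultrafilterSets U) ↔ ∃ T ∈ U, x * e 𝕂 T = 0 := by
  constructor
  · intro hx
    induction hx using Submodule.span_induction with
    | mem x h =>
      obtain ⟨S, hS, rfl⟩ := h
      refine ⟨Sᶜ, hS.2, ?_⟩
      rw [e_mul_e, inter_compl_self]
      simp only [e, indicator_empty]
      exact map_zero _
    | zero => exact ⟨univ, univ_mem, zero_mul _⟩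
    | add x y _ _ hx hy =>
      obtain ⟨S, hS, hxS⟩ := hx
      obtain ⟨T, hT, hyT⟩ := hy
      refine ⟨S ∩ T, inter_mem hS hT, ?_⟩
      rw [← e_mul_e]
      linear_combination e 𝕂 T * hxS + e 𝕂 S * hyT
    | smul a x _ hx =>
      obtain ⟨S, hS, hxS⟩ := hx
      exact ⟨S, hS, by rw [smul_eq_mul, mul_assoc, hxS, mul_zero]⟩
  · rintro ⟨T, hT, hx⟩
    have : x = x * e 𝕂 Tᶜ := by
      linear_combination (-x) * e_add_e_compl (𝕂 := 𝕂) T + hx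
    rw [this]
    exact Ideal.mul_mem_left _ _ (e_mem_g hU (by rwa [compl_compl]))

theorem one_notMem_g {U : Ultrafilter Param} (hU : (U : Filter Param) ≤ atBot) :
    (1 : GenNum 𝕂) ∉ g 𝕂 (ultrafilterSets U) := by
  rw [mem_g_iff hU]
  rintro ⟨T, hT, h⟩
  rw [one_mul] at h
  exact not_zeroAdherent_of_e_eq_zero h (zeroAdherent_of_mem hU hT)

theorem isBigPow_of_sharpNorm_lt {u : moderate 𝕂} {a : ℝ}
    (h : (GenNum.mk u).sharpNorm < Real.exp (-a)) : IsBigPow (u : Param → 𝕂) a := by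
  apply isBigPow_of_lt
  rw [GenNum.sharpNorm, ← ENNReal.lt_ofReal_iff_toReal_lt (GenNum.exp_ne_top _), ← EReal.exp_coe,
    EReal.exp_lt_exp_iff, EReal.coe_neg, EReal.neg_lt_neg_iff, GenNum.val_mk] at h
  exact h

/-! ### P-points at zero: closedness, maximality, minimality -/

/-- Ultrafilters below `atBot` in which each sequence of members has a pseudo-intersection
modulo `atBot`. -/
def IsPPointAtZero (U : Ultrafilter Param) : Prop :=
  (U : Filter Param) ≤ atBot ∧ ∀ A : ℕ → Set Param, (∀ m, A m ∈ U) →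
    ∃ T ∈ U, ∀ m, ∀ᶠ ε in atBot, ε ∈ T → ε ∈ A m

theorem exists_isPPointAtZero (CH : Cardinal.continuum.{0} = Cardinal.aleph 1) :
    ∃ U : Ultrafilter Param, IsPPointAtZero U := by
  obtain ⟨V, hV, hP⟩ := Ultrafilter.exists_pPoint CH
  -- The value is `1 / (n + 2)`, to stay below `1` at `n = 0`.
  let φ : ℕ → Param := fun n => ⟨1 / ((n + 1 : ℕ) + 1), by positivity, by
    rw [div_lt_one (by positivity)]
    exact lt_add_of_pos_left _ (by positivity)⟩
  have hφ : Tendsto φ atTop atBot := by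
    refine tendsto_atBot.2 fun b => ?_
    have h := (tendsto_one_div_add_atTop_nhds_zero_nat (𝕜 := ℝ)).comp (tendsto_add_atTop_nat 1)
    filter_upwards [h.eventually_lt_const b.2.1] with n hn
    exact hn.le
  have hfin : ∀ s : Set Param, s.Finite → sᶜ ∈ (atBot : Filter Param) := fun s hs =>
    atBot_le_cofinite hs.compl_mem_cofinite
  refine ⟨V.map φ, (map_mono (hV.trans Nat.cofinite_eq_atTop.le)).trans hφ, fun A hA => ?_⟩
  obtain ⟨T, hT, hTA⟩ := hP (fun m => φ ⁻¹' A m) hA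
  refine ⟨φ '' T, image_mem_map hT, fun m => ?_⟩
  filter_upwards [hfin _ ((hTA m).image φ)] with ε hε hεT
  obtain ⟨n, hn, rfl⟩ := hεT
  by_contra h
  exact hε ⟨n, ⟨hn, h⟩, rfl⟩

theorem mk_mem_g {U : Ultrafilter Param} (hU : IsPPointAtZero U) {u : moderate 𝕂}
    (h : ∀ m : ℕ, {ε : Param | ‖(u : Param → 𝕂) ε‖ ≤ (ε : ℝ) ^ (m : ℝ)} ∈ U) :
    GenNum.mk u ∈ g 𝕂 (ultrafilterSets U) := by
  obtain ⟨T, hT, hTA⟩ := hU.2 _ h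
  refine (mem_g_iff hU.1).2 ⟨T, hT, mk_mul_e_eq_zero_iff.2 fun a => ?_⟩
  obtain ⟨m, hm⟩ := exists_nat_ge a
  filter_upwards [hTA m] with ε hε hεT
  exact (hε hεT).trans (Real.rpow_le_rpow_of_exponent_ge ε.2.1 ε.2.2.le hm)

theorem isClosed_g {U : Ultrafilter Param} (hU : IsPPointAtZero U) :
    IsClosed (g 𝕂 (ultrafilterSets U) : Set (GenNum 𝕂)) := by
  refine isClosed_of_closure_subset fun x hx => ?_
  obtain ⟨u, rfl⟩ := GenNum.mk_surjective x
  refine mk_mem_g hU fun m => ?_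
  -- On `T`, `u = (u - w) + w` with both terms of order `m + 1`; the extra unit absorbs the factor
  -- `2` of the sum.
  obtain ⟨y, hy, hd⟩ := Metric.mem_closure_iff.1 hx _ (Real.exp_pos (-(m + 1 : ℝ)))
  obtain ⟨w, rfl⟩ := GenNum.mk_surjective y
  obtain ⟨T, hT, hw⟩ := (mem_g_iff hU.1).1 hy
  have h1 : IsBigPow ((u - w : moderate 𝕂) : Param → 𝕂) (m + 1) := by
    refine isBigPow_of_sharpNorm_lt ?_
    rw [map_sub]
    exact hd
  have h2 : IsBigPow (T.indicator ((u - w : moderate 𝕂) : Param → 𝕂)) (m + 1) := by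
    rw [isBigPow_iff_eventually] at h1 ⊢
    filter_upwards [h1] with ε hε
    exact (norm_indicator_le_norm_self _ _).trans hε
  have h3 : IsBigPow (T.indicator (w : Param → 𝕂)) (m + 1) := by
    rw [isBigPow_iff_eventually]
    filter_upwards [mk_mul_e_eq_zero_iff.1 hw (m + 1)] with ε hε
    by_cases h : ε ∈ T
    · simpa [h] using hε h
    · simp [h, Real.rpow_nonneg ε.2.1.le]
  have h4 := isBigPow_iff_eventually.1 (h2.add h3 (lt_add_one (m : ℝ)))
  filter_upwards [hU.1 h4, hT] with ε hε hεT
  simpa [hεT] using hε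

/-- The lower bound makes the pointwise inverse, cut off outside `T`, moderate. -/
theorem exists_mul_mk_eq_e {u : moderate 𝕂} {T : Set Param} {a : ℝ}
    (h : ∀ ε ∈ T, (ε : ℝ) ^ a ≤ ‖(u : Param → 𝕂) ε‖) : ∃ y, y * GenNum.mk u = e 𝕂 T := by
  have hmod : T.indicator (u : Param → 𝕂)⁻¹ ∈ moderate 𝕂 := by
    refine ⟨-a, isBigPow_iff_eventually.2 (Eventually.of_forall fun ε => ?_)⟩
    by_cases hε : ε ∈ T
    · rw [indicator_of_mem hε, Pi.inv_apply, norm_inv, Real.rpow_neg ε.2.1.le]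
      exact inv_anti₀ (Real.rpow_pos_of_pos ε.2.1 _) (h ε hε)
    · simp [hε, Real.rpow_nonneg ε.2.1.le]
  refine ⟨GenNum.mk ⟨_, hmod⟩, ?_⟩
  rw [e, ← map_mul]
  congr 1
  ext ε
  by_cases hε : ε ∈ T
  · have : (u : Param → 𝕂) ε ≠ 0 :=
      norm_pos_iff.1 ((Real.rpow_pos_of_pos ε.2.1 a).trans_le (h ε hε))
    simp [hε, this]
  · simp [hε]

theorem isMaximal_g {U : Ultrafilter Param} (hU : IsPPointAtZero U) :
    (g 𝕂 (ultrafilterSets U)).IsMaximal := by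
  refine Ideal.isMaximal_iff.2 ⟨one_notMem_g hU.1, fun J x hJ hx hxJ => ?_⟩
  obtain ⟨u, rfl⟩ := GenNum.mk_surjective x
  obtain ⟨m, hm⟩ : ∃ m : ℕ, {ε : Param | ‖(u : Param → 𝕂) ε‖ ≤ (ε : ℝ) ^ (m : ℝ)} ∉ U := by
    by_contra! h
    exact hx (mk_mem_g hU h)
  obtain ⟨y, hy⟩ := exists_mul_mk_eq_e (u := u) (a := m)
    (T := {ε : Param | ‖(u : Param → 𝕂) ε‖ ≤ (ε : ℝ) ^ (m : ℝ)}ᶜ) fun ε hε => le_of_not_ge fun h => hε h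
  -- The first idempotent is in the ideal since the complement of its set is in `U`; the second is a
  -- multiple of `u`.
  rw [← e_add_e_compl {ε : Param | ‖(u : Param → 𝕂) ε‖ ≤ (ε : ℝ) ^ (m : ℝ)}, ← hy]
  refine J.add_mem (hJ (e_mem_g hU.1 ?_)) (J.mul_mem_left _ hxJ)
  exact U.compl_mem_iff_notMem.2 hm

theorem g_mem_minimalPrimes {U : Ultrafilter Param} (hU : (U : Filter Param) ≤ atBot)
    (hP : (g 𝕂 (ultrafilterSets U)).IsPrime) :
    g 𝕂 (ultrafilterSets U) ∈ minimalPrimes (GenNum 𝕂) := by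
  refine ⟨⟨hP, bot_le⟩, fun P hP hle => Ideal.span_le.2 ?_⟩
  rintro _ ⟨S, hS, rfl⟩
  have h0 : e 𝕂 S * e 𝕂 Sᶜ ∈ P := by
    rw [e_mul_e, inter_compl_self, e_eq_zero_of_not_zeroAdherent (by simp [ZeroAdherent])]
    exact P.zero_mem
  refine (hP.1.mem_or_mem h0).resolve_right fun h => one_notMem_g (𝕂 := 𝕂) hU ?_
  rw [← e_add_e_compl S]
  exact add_mem (Ideal.subset_span ⟨S, hS, rfl⟩) (hle h)

end Colombeau

theorem mainTheorem10 (𝕂 : Type*) [RCLike 𝕂]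
    (CH : Cardinal.continuum.{0} = Cardinal.aleph 1) :
    ∃ F ∈ Colombeau.PStar,
      IsClosed (Colombeau.g 𝕂 F : Set (Colombeau.GenNum 𝕂)) ∧
      (Colombeau.g 𝕂 F).IsMaximal ∧
      Colombeau.g 𝕂 F ∈ minimalPrimes (Colombeau.GenNum 𝕂) := by
  obtain ⟨U, hU⟩ := Colombeau.exists_isPPointAtZero CH
  exact ⟨Colombeau.ultrafilterSets U, Colombeau.ultrafilterSets_mem_PStar hU.1,
    Colombeau.isClosed_g hU, Colombeau.isMaximal_g hU,
    Colombeau.g_mem_minimalPrimes hU.1 (Colombeau.isMaximal_g hU).isPrime⟩
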